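/- Let $\Bbbk$ be a commutative ring and $X$ a set. Let $\mathcal{BR}(X)$ be the free $\Bbbk$-module on the $X$-colored planar rooted trees, and let $T(\mathcal{BR}(X))$ be its tensor algebra, with its basis of planar forests $T_1\cdots T_n$ (words in trees). Write $\Delta(A)=A_{(1)}\otimes A_{(2)}$ for the deconcatenation coproduct of a tensor algebra $T(V)$. A brace algebra structure on a $\Bbbk$-module $V$ is a linear map $V\otimes T(V)\to V$, $Y\otimes A\mapsto Y\{A\}$, such that $Y\{1\}=Y$ and $$Y\{Y_1\cdots Y_n\}\{A\}=Y\{A_{(1)}\,Y_1\{A_{(2)}\}\,A_{(3)}\cdots A_{(2n-1)}\,Y_n\{A_{(2n)}\}\,A_{(2n+1)}\}.$$ Equip $\mathcal{BR}(X)$ with its unique brace algebra structure such that $\bullet_x\{T_1\cdots T_n\}$ is the tree with root colored by $x$ and branches $T_1,\dots,T_n$ (in this order), for all $x\in X$ and all trees $T_i$, where $\bullet_x$ is the one-vertex tree colored by $x$; explicitly, $T\{T_1\cdots T_n\}$ is the sum over all order-preserving ways of grafting $T_1,\dots,T_n$ on the sectors of $T$. Let $*$ be the product on $T(\mathcal{BR}(X))$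 determined by $$1*B=B,\qquad YA*B=B_{(1)}\,Y\{B_{(2)}\}\,(A*B_{(3)})\qquad(Y\in\mathcal{BR}(X)).$$ Let $\Delta_F$ be the coproduct of Foissy's Hopf algebra of $X$-colored planar rooted trees: the algebra morphism $T(\mathcal{BR}(X))\to T(\mathcal{BR}(X))\otimes T(\mathcal{BR}(X))$, for the concatenation product, with $\Delta_F(T)=\sum_c P^c(T)\otimes R^c(T)$ for each tree $T$, where $c$ runs over the admissible cuts of $T$ (including the empty cut, which gives $1\otimes T$, and the total cut, which gives $T\otimes 1$), $P^c(T)$ is the planar forest cut off and $R^c(T)$ is the part containing the root. Then $\Delta_F$ is dual to the opposite of $*$: if $\langle\cdot,\cdot\rangle$ is the bilinear form on $T(\mathcal{BR}(X))$ for which the planar forests are orthonormal, and $\langle A\otimes B,C\otimes D\rangle=\langle A,C\rangle\langle B,D\rangle$, then for all $A,B,C\in T(\mathcal{BR}(X))$ $$\langle \Delta_F(C),A\otimes B\rangle=\langle C,\,B*A\rangle .$$ -/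

import Mathlib

open scoped TensorProduct

noncomputable section

namespace BraceAlgebra

section Tensor
variable (k : Type*) [CommRing k] {V : Type*} [AddCommGroup V] [Module k V]

/-- The word `X₁ ⋯ Xₙ` in the tensor algebra `T(V)`. -/
def word (Xs : List V) : TensorAlgebra k V := (Xs.map (TensorAlgebra.ι k)).prod

/-- The recursion step `(d, A) ↦ (1 ⊗ XA + (X ⊗ 1) d, XA)` for the deconcatenation coproduct. -/
def deconcatStep : V →ₗ[k] Module.End k
    ((TensorAlgebra k V ⊗[k] TensorAlgebra k V) × TensorAlgebra k V) :=
  LinearMap.mk₂ k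
    (fun X p => ((1 : TensorAlgebra k V) ⊗ₜ[k] (TensorAlgebra.ι k X * p.2) +
      (TensorAlgebra.ι k X ⊗ₜ[k] (1 : TensorAlgebra k V)) * p.1, TensorAlgebra.ι k X * p.2))
    (by intro X Y p; ext1 <;>
          simp [add_mul, TensorProduct.tmul_add, TensorProduct.add_tmul]; abel)
    (by intro c X p; ext1 <;> simp [← TensorProduct.smul_tmul'])
    (by intro X p q; ext1 <;>
          simp [mul_add, TensorProduct.tmul_add]; abel)
    (by intro c X p; ext1 <;> simp)

/-- The deconcatenation coproduct of `T(V)`,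
`Δ(X₁ ⋯ Xₙ) = ∑ᵢ X₁ ⋯ Xᵢ ⊗ Xᵢ₊₁ ⋯ Xₙ`; see `deconcat_word`. -/
def deconcat : TensorAlgebra k V →ₗ[k] TensorAlgebra k V ⊗[k] TensorAlgebra k V :=
  LinearMap.fst k _ _ ∘ₗ LinearMap.applyₗ ((1 : TensorAlgebra k V) ⊗ₜ[k] (1 : TensorAlgebra k V), 1) ∘ₗ
    (TensorAlgebra.lift k (deconcatStep k (V := V))).toLinearMap

theorem deconcat_one : deconcat k (1 : TensorAlgebra k V) = 1 ⊗ₜ 1 := by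
  simp [deconcat]

theorem deconcat_snd (A : TensorAlgebra k V) :
    (TensorAlgebra.lift k (deconcatStep k (V := V)) A (1 ⊗ₜ 1, 1)).2 = A := by
  suffices h : ∀ q, (TensorAlgebra.lift k (deconcatStep k (V := V)) A q).2 = A * q.2 by
    simp [h]
  induction A using TensorAlgebra.induction with
  | algebraMap r => intro q; simp [Algebra.smul_def, Module.algebraMap_end_apply]
  | ι X => intro q; simp [deconcatStep]
  | mul a b ha hb => intro q; simp [ha, hb, mul_assoc]
  | add a b ha hb => intro q; simp [ha, hb, add_mul]

theorem deconcat_ι_mul (X : V) (A : TensorAlgebra k V) :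
    deconcat k (TensorAlgebra.ι k X * A) =
      1 ⊗ₜ (TensorAlgebra.ι k X * A) + (TensorAlgebra.ι k X ⊗ₜ 1) * deconcat k A := by
  have h := deconcat_snd k A
  simp only [deconcat, LinearMap.comp_apply, AlgHom.toLinearMap_apply, map_mul,
    TensorAlgebra.lift_ι_apply, LinearMap.applyₗ_apply_apply, LinearMap.fst_apply,
    Module.End.mul_apply]
  generalize TensorAlgebra.lift k (deconcatStep k) A (1 ⊗ₜ 1, 1) = p at h
  simp [deconcatStep, h]

theorem deconcat_word (Xs : List V) :
    deconcat k (word k Xs) =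
      ∑ i ∈ Finset.range (Xs.length + 1), word k (Xs.take i) ⊗ₜ[k] word k (Xs.drop i) := by
  induction Xs with
  | nil => simp [word, deconcat_one]
  | cons X Xs ih =>
    have : word k (X :: Xs) = TensorAlgebra.ι k X * word k Xs := by simp [word]
    rw [this, deconcat_ι_mul, ih, List.length_cons, Finset.sum_range_succ' _ (Xs.length + 1), add_comm,
      Finset.mul_sum]
    simp [word]

variable {k}

/-- The map `A ↦ A₍₁₎ X{A₍₂₎}` attached to a candidate brace operation `β` and `X ∈ V`
(it is linear in `X`). -/
def insertOne (β : V →ₗ[k] TensorAlgebra k V →ₗ[k] V) :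
    V →ₗ[k] TensorAlgebra k V →ₗ[k] TensorAlgebra k V :=
  LinearMap.mk₂ k
    (fun X A => LinearMap.mul' k (TensorAlgebra k V)
      ((TensorAlgebra.ι k ∘ₗ β X).lTensor (TensorAlgebra k V) (deconcat k A)))
    (by intro X Y A; simp [LinearMap.comp_add, LinearMap.lTensor_add])
    (by intro c X A; simp [LinearMap.comp_smul, LinearMap.lTensor_smul])
    (by intro X A B; simp)
    (by intro c X A; simp)

/-- The map `A ↦ A₍₁₎ Y₁{A₍₂₎} A₍₃₎ ⋯ A₍₂ₙ₋₁₎ Yₙ{A₍₂ₙ₎} A₍₂ₙ₊₁₎` attached to a candidate brace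
operation `β` and `Y₁, …, Yₙ ∈ V`. -/
def insertBraces (β : V →ₗ[k] TensorAlgebra k V →ₗ[k] V) :
    List V → TensorAlgebra k V →ₗ[k] TensorAlgebra k V
  | [] => LinearMap.id
  | Y :: Ys => LinearMap.mul' k (TensorAlgebra k V) ∘ₗ
      TensorProduct.map (insertOne β Y) (insertBraces β Ys) ∘ₗ deconcat k

/-- One recursion step of the `*` product: `φ ↦ (B ↦ B₍₁₎ X{B₍₂₎} φ(B₍₃₎))`, linear in `X`. -/
def starStep (β : V →ₗ[k] TensorAlgebra k V →ₗ[k] V) :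
    V →ₗ[k] Module.End k (Module.End k (TensorAlgebra k V)) :=
  LinearMap.mk₂ k
    (fun X φ => LinearMap.mul' k (TensorAlgebra k V) ∘ₗ
      TensorProduct.map (insertOne β X) φ ∘ₗ deconcat k)
    (by intro X Y φ; simp [TensorProduct.map_add_left, LinearMap.add_comp, LinearMap.comp_add])
    (by intro c X φ; simp [TensorProduct.map_smul_left, LinearMap.smul_comp, LinearMap.comp_smul])
    (by intro X φ ψ; simp [TensorProduct.map_add_right, LinearMap.add_comp, LinearMap.comp_add])
    (by intro c X φ
        simp [TensorProduct.map_smul_right, LinearMap.smul_comp, LinearMap.comp_smul])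

/-- The bilinear `*` product on `T(V)` attached to `β`. It is determined by `1 * B = B` and
`XA * B = B₍₁₎ X{B₍₂₎} (A * B₍₃₎)`; see `starOf_one` and `starOf_ι_mul`. -/
def starOf (β : V →ₗ[k] TensorAlgebra k V →ₗ[k] V) :
    TensorAlgebra k V →ₗ[k] TensorAlgebra k V →ₗ[k] TensorAlgebra k V :=
  LinearMap.applyₗ (LinearMap.id : Module.End k (TensorAlgebra k V)) ∘ₗ
    (TensorAlgebra.lift k (starStep β)).toLinearMap

theorem starOf_one (β : V →ₗ[k] TensorAlgebra k V →ₗ[k] V) (B : TensorAlgebra k V) :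
    starOf β 1 B = B := by
  simp [starOf]

theorem starOf_ι_mul (β : V →ₗ[k] TensorAlgebra k V →ₗ[k] V) (X : V) (A B : TensorAlgebra k V) :
    starOf β (TensorAlgebra.ι k X * A) B =
      LinearMap.mul' k (TensorAlgebra k V)
        (TensorProduct.map (insertOne β X) (starOf β A) (deconcat k B)) := by
  simp [starOf, starStep]

theorem starOf_word (β : V →ₗ[k] TensorAlgebra k V →ₗ[k] V) (Ys : List V)
    (A : TensorAlgebra k V) : starOf β (word k Ys) A = insertBraces β Ys A := by
  have h : starOf β (word k Ys) = insertBraces β Ys := by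
    induction Ys with
    | nil => ext A : 1; simp [word, starOf_one, insertBraces]
    | cons Y Ys ih =>
      ext A : 1
      have : word k (Y :: Ys) = TensorAlgebra.ι k Y * word k Ys := by simp [word]
      rw [this, starOf_ι_mul, ih]
      rfl
  rw [h]

end Tensor
end BraceAlgebra

open BraceAlgebra in
/-- A brace algebra structure on the `k`-module `V`: a linear map `V ⊗ T(V) → V`,
`X ⊗ A ↦ X{A}`, with `X{1} = X` and
`X{Y₁ ⋯ Yₙ}{A} = X{A₍₁₎ Y₁{A₍₂₎} A₍₃₎ ⋯ A₍₂ₙ₋₁₎ Yₙ{A₍₂ₙ₎} A₍₂ₙ₊₁₎}`. -/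
class BraceAlgebra (k : Type*) [CommRing k] (V : Type*) [AddCommGroup V] [Module k V] where
  brace : V →ₗ[k] TensorAlgebra k V →ₗ[k] V
  brace_one : ∀ X : V, brace X 1 = X
  brace_brace : ∀ (X : V) (Ys : List V) (A : TensorAlgebra k V),
    brace (brace X (word k Ys)) A = brace X (insertBraces brace Ys A)

/-- The `*` product on `T(V)` of a brace algebra `V`. -/
def BraceAlgebra.starMul (k : Type*) [CommRing k] (V : Type*) [AddCommGroup V] [Module k V]
    [BraceAlgebra k V] : TensorAlgebra k V →ₗ[k] TensorAlgebra k V →ₗ[k] TensorAlgebra k V :=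
  starOf (brace (k := k) (V := V))

/-- `X`-coloured planar rooted trees: a root with its colour and the ordered list of the subtrees
above it. -/
inductive PlanarTree (X : Type*) where
  | node : X → List (PlanarTree X) → PlanarTree X

namespace PlanarTree
open BraceAlgebra
variable {X : Type*}

/-- All the ways to write a word as a concatenation of two words. -/
def splits {α : Type*} : List α → Multiset (List α × List α)
  | [] => {([], [])}
  | a :: A => ([], a :: A) ::ₘ (splits A).map fun p => (a :: p.1, p.2)

mutual
/-- The graftings of a planar forest `A = T₁ ⋯ Tₙ` on a tree `T`, listed with multiplicity.
A vertex with `m` branches has `m + 1` sectors, which alternate with its branches; going around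
`T` from left to right orders all the sectors of `T`. A grafting is a weakly increasing map from
`{1, …, n}` to the sectors of `T`, that is, a way to cut the word `A` into consecutive (possibly
empty) subwords, one for each sector, which are then inserted there as new branches. -/
def graft : PlanarTree X → List (PlanarTree X) → Multiset (PlanarTree X)
  | node x F, A => (graftForest F A).map (node x)
/-- The same for a planar forest in place of `T`, with the sectors outside of the trees included:
before, between and after the trees of the forest. -/
def graftForest : List (PlanarTree X) → List (PlanarTree X) → Multiset (List (PlanarTree X))
  | [], A => {A}
  | t :: F, A =>
      (splits A).bind fun p => (splits p.2).bind fun q =>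
        (graft t q.1).bind fun t' => (graftForest F q.2).map fun F' => p.1 ++ t' :: F'
end

theorem splits_coassoc {α β : Type*} (A : List α) (g : List α → List α → List α → Multiset β) :
    ((splits A).bind fun p => (splits p.1).bind fun q => g q.1 q.2 p.2) =
      (splits A).bind fun p => (splits p.2).bind fun q => g p.1 q.1 q.2 := by
  induction A generalizing g with
  | nil => simp [splits]
  | cons a A ih =>
    simp only [splits, Multiset.cons_bind, Multiset.bind_map, Multiset.singleton_bind, 
      Multiset.bind_add]
    rw [ih (fun P Q R => g (a :: P) Q R)]
    simp [add_assoc]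

theorem splits_append {α β : Type*} (A : List α) (y : α) (B : List α)
    (g : List α → List α → Multiset β) :
    ((splits (A ++ y :: B)).bind fun p => g p.1 p.2) =
      ((splits A).bind fun p => g p.1 (p.2 ++ y :: B)) +
        (splits B).bind fun p => g (A ++ y :: p.1) p.2 := by
  induction A generalizing g with
  | nil => simp [splits, Multiset.cons_bind, Multiset.bind_map]
  | cons a A ih =>
    simp only [splits, List.cons_append, Multiset.cons_bind, Multiset.bind_map]
    rw [ih (fun P Q => g (a :: P) Q)]
    simp [add_assoc]

theorem graftForest_append (F : List (PlanarTree X)) (t : PlanarTree X) (G C : List (PlanarTree X)) :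
    graftForest (F ++ t :: G) C =
      (splits C).bind fun p => (splits p.2).bind fun q =>
        (graftForest F p.1).bind fun P => (graft t q.1).bind fun t' =>
          (graftForest G q.2).map fun Q => P ++ t' :: Q := by
  induction F generalizing C with
  | nil => simp [graftForest]
  | cons s F ih =>
    let K : List (PlanarTree X) → List (PlanarTree X) → List (PlanarTree X) →
        List (PlanarTree X) → List (PlanarTree X) → Multiset (List (PlanarTree X)) :=
      fun c₁ c₂ c₃ c₄ c₅ => (graft s c₂).bind fun s' => (graftForest F c₃).bind fun P =>
        (graft t c₄).bind fun t' => (graftForest G c₅).map fun Q => c₁ ++ s' :: (P ++ t' :: Q)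
    have hL : graftForest (s :: F ++ t :: G) C =
        (splits C).bind fun a => (splits a.2).bind fun b => (splits b.2).bind fun c =>
          (splits c.2).bind fun d => K a.1 b.1 c.1 d.1 d.2 := by
      simp only [List.cons_append, graftForest]
      refine Multiset.bind_congr fun a _ => Multiset.bind_congr fun b _ => ?_
      simp only [ih, Multiset.map_bind, Multiset.map_map, Function.comp_def, K]
      rw [Multiset.bind_bind]
      refine Multiset.bind_congr fun c _ => ?_
      rw [Multiset.bind_bind]
    have hR : ((splits C).bind fun p => (splits p.2).bind fun q =>
        (graftForest (s :: F) p.1).bind fun P => (graft t q.1).bind fun t' =>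
          (graftForest G q.2).map fun Q => P ++ t' :: Q) =
        (splits C).bind fun p => (splits p.1).bind fun a => (splits a.2).bind fun b =>
          (splits p.2).bind fun d => K a.1 b.1 b.2 d.1 d.2 := by
      refine Multiset.bind_congr fun p _ => ?_
      simp only [graftForest, Multiset.bind_assoc, Multiset.bind_map, K]
      rw [Multiset.bind_bind]
      refine Multiset.bind_congr fun a _ => ?_
      rw [Multiset.bind_bind]
      refine Multiset.bind_congr fun b _ => Multiset.bind_congr fun d _ => ?_
      simp
    rw [hL, hR, splits_coassoc C (fun u v w => (splits v).bind fun b =>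
      (splits w).bind fun d => K u b.1 b.2 d.1 d.2)]
    refine Multiset.bind_congr fun a _ => ?_
    rw [splits_coassoc a.2 (fun u v w => (splits w).bind fun d => K a.1 u v d.1 d.2)]

theorem splits_graftForest {β : Type*} (F A : List (PlanarTree X))
    (g : List (PlanarTree X) → List (PlanarTree X) → Multiset β) :
    ((graftForest F A).bind fun R => (splits R).bind fun r => g r.1 r.2) =
      (splits F).bind fun f => (splits A).bind fun a =>
        (graftForest f.1 a.1).bind fun P => (graftForest f.2 a.2).bind fun Q => g P Q := by
  induction F generalizing A g with
  | nil => simp [graftForest, splits]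
  | cons t F ih =>
    simp only [graftForest, splits, Multiset.bind_assoc, Multiset.bind_map,
      Multiset.cons_bind, splits_append, Multiset.bind_add, Multiset.singleton_bind]
    congr 1
    · simp only [fun (a : List (PlanarTree X) × List (PlanarTree X))
          (b : List (PlanarTree X) × List (PlanarTree X)) (t' : PlanarTree X) =>
          Multiset.bind_bind (graftForest F b.2) (splits a.1)
            (f := fun F' p => g p.1 (p.2 ++ t' :: F')),
        fun (a : List (PlanarTree X) × List (PlanarTree X))
          (b : List (PlanarTree X) × List (PlanarTree X)) =>
          Multiset.bind_bind (graft t b.1) (splits a.1)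
            (f := fun t' p => (graftForest F b.2).bind fun F' => g p.1 (p.2 ++ t' :: F')),
        fun (a : List (PlanarTree X) × List (PlanarTree X)) =>
          Multiset.bind_bind (splits a.2) (splits a.1) (f := fun b p =>
            (graft t b.1).bind fun t' =>
              (graftForest F b.2).bind fun F' => g p.1 (p.2 ++ t' :: F'))]
      rw [splits_coassoc A (fun u v w => (splits w).bind fun q => (graft t q.1).bind fun t' =>
        (graftForest F q.2).bind fun F' => g u (v ++ t' :: F'))]
    · have h1 : ∀ a : List (PlanarTree X) × List (PlanarTree X),
          ((splits a.2).bind fun b => (graft t b.1).bind fun t' =>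
            (graftForest F b.2).bind fun F' => (splits F').bind fun p =>
              g (a.1 ++ t' :: p.1) p.2) =
          (splits F).bind fun f => (splits a.2).bind fun b => (splits b.2).bind fun c =>
            (graft t b.1).bind fun t' => (graftForest f.1 c.1).bind fun P =>
              (graftForest f.2 c.2).bind fun Q => g (a.1 ++ t' :: P) Q := by
        intro a
        rw [Multiset.bind_bind (splits F)]
        refine Multiset.bind_congr fun b _ => ?_
        simp only [fun t' => ih b.2 (fun P Q => g (a.1 ++ t' :: P) Q)]
        rw [Multiset.bind_bind]
        refine Multiset.bind_congr fun f _ => ?_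
        rw [Multiset.bind_bind]
      simp only [h1]
      rw [Multiset.bind_bind]
      refine Multiset.bind_congr fun f _ => ?_
      let K : List (PlanarTree X) → List (PlanarTree X) → List (PlanarTree X) →
          List (PlanarTree X) → Multiset β := fun u v w z =>
        (graft t v).bind fun t' => (graftForest f.1 w).bind fun P =>
          (graftForest f.2 z).bind fun Q => g (u ++ t' :: P) Q
      calc _ = (splits A).bind fun a => (splits a.2).bind fun b => (splits b.1).bind fun c =>
              K a.1 c.1 c.2 b.2 := by
            refine Multiset.bind_congr fun a _ => ?_
            rw [splits_coassoc a.2 (fun u v w => K a.1 u v w)]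
        _ = (splits A).bind fun a => (splits a.1).bind fun b => (splits b.2).bind fun c =>
              K b.1 c.1 c.2 a.2 := by
            rw [← splits_coassoc A (fun u v w => (splits v).bind fun c => K u c.1 c.2 w)]
        _ = _ := rfl

mutual
theorem graft_graft : ∀ (t : PlanarTree X) (B C : List (PlanarTree X)),
    ((graft t B).bind fun t' => graft t' C) = (graftForest B C).bind fun S => graft t S
  | node x F, B, C => by
    have := congrArg (Multiset.map (node x)) (graftForest_assoc F B C)
    simpa only [graft, Multiset.bind_map, Multiset.map_bind] using this
theorem graftForest_assoc : ∀ F B C : List (PlanarTree X),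
    ((graftForest F B).bind fun R => graftForest R C) =
      (graftForest B C).bind fun S => graftForest F S
  | [], B, C => by
    simpa [graftForest] using (Multiset.bind_singleton (s := graftForest B C) id).symm
  | t :: F, B, C => by
    let K : List (PlanarTree X) → List (PlanarTree X) → List (PlanarTree X) →
        List (PlanarTree X) → List (PlanarTree X) → List (PlanarTree X) →
        Multiset (List (PlanarTree X)) := fun b₁ b₂ b₃ c₁ c₂ c₃ =>
      (graftForest b₁ c₁).bind fun P => (graftForest b₂ c₂).bind fun S =>
        (graft t S).bind fun t' => (graftForest b₃ c₃).bind fun S' =>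
          (graftForest F S').map fun Q => P ++ t' :: Q
    trans (splits B).bind fun a => (splits a.2).bind fun b => (splits C).bind fun c =>
      (splits c.2).bind fun d => K a.1 b.1 b.2 c.1 d.1 d.2
    · simp only [graftForest, Multiset.bind_assoc, Multiset.bind_map, graftForest_append]
      refine Multiset.bind_congr fun a _ => Multiset.bind_congr fun b _ => ?_
      calc _ = (splits C).bind fun c => (splits c.2).bind fun d =>
            (graftForest a.1 c.1).bind fun P => (graft t b.1).bind fun t' =>
              (graftForest F b.2).bind fun F' => (graft t' d.1).bind fun t'' =>
                (graftForest F' d.2).map fun Q => P ++ t'' :: Q := by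
            simp only [fun t' => Multiset.bind_bind (graftForest F b.2) (splits C)
              (f := fun F' c => (splits c.2).bind fun d => (graftForest a.1 c.1).bind fun P =>
                (graft t' d.1).bind fun t'' => (graftForest F' d.2).map fun Q => P ++ t'' :: Q)]
            rw [Multiset.bind_bind]
            refine Multiset.bind_congr fun c _ => ?_
            simp only [fun t' => Multiset.bind_bind (graftForest F b.2) (splits c.2)
              (f := fun F' d => (graftForest a.1 c.1).bind fun P =>
                (graft t' d.1).bind fun t'' => (graftForest F' d.2).map fun Q => P ++ t'' :: Q)]
            rw [Multiset.bind_bind]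
            refine Multiset.bind_congr fun d _ => ?_
            simp only [fun t' => Multiset.bind_bind (graftForest F b.2) (graftForest a.1 c.1)
              (f := fun F' P =>
                (graft t' d.1).bind fun t'' => (graftForest F' d.2).map fun Q => P ++ t'' :: Q)]
            rw [Multiset.bind_bind]
        _ = _ := by
            refine Multiset.bind_congr fun c _ => Multiset.bind_congr fun d _ =>
              Multiset.bind_congr fun P _ => ?_
            have h1 := congrArg (fun m => m.bind fun t'' =>
              ((graftForest F b.2).bind fun F' => graftForest F' d.2).map fun Q => P ++ t'' :: Q)
              (graft_graft t b.1 d.1)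
            have h2 := fun t'' => congrArg (Multiset.map fun Q => P ++ t'' :: Q)
              (graftForest_assoc F b.2 d.2)
            simp only [Multiset.bind_assoc, Multiset.map_bind] at h1 h2
            simp only [fun t' => Multiset.bind_bind (graftForest F b.2) (graft t' d.1)
              (f := fun F' t'' => (graftForest F' d.2).map fun Q => P ++ t'' :: Q)]
            rw [h1]
            simp only [h2]
    · simp only [graftForest]
      rw [splits_graftForest B C fun p r => (splits r).bind fun q => (graft t q.1).bind fun t' =>
        (graftForest F q.2).map fun F' => p ++ t' :: F']
      refine Multiset.bind_congr fun a _ => ?_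
      rw [Multiset.bind_bind]
      refine Multiset.bind_congr fun c _ => ?_
      simp only [fun P => splits_graftForest a.2 c.2 fun u v => (graft t u).bind fun t' =>
        (graftForest F v).map fun F' => P ++ t' :: F']
      rw [Multiset.bind_bind (graftForest a.1 c.1)]
      refine Multiset.bind_congr fun b _ => ?_
      rw [Multiset.bind_bind (graftForest a.1 c.1)]
      refine Multiset.bind_congr fun d _ => Multiset.bind_congr fun P _ =>
        Multiset.bind_congr fun S _ => ?_
      rw [Multiset.bind_bind]
end

/-! The brace algebra of planar rooted trees. -/

section Module
variable (k : Type*) [CommRing k] (X : Type*)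

/-- The free `k`-module `BR(X)` on the `X`-coloured planar rooted trees. -/
abbrev BR : Type _ := PlanarTree X →₀ k

variable {X}

/-- A tree as an element of `BR(X)`. -/
def tree (t : PlanarTree X) : BR k X := Finsupp.single t 1

/-- A planar forest `T₁ ⋯ Tₙ` as an element of `T(BR(X))`. -/
def forest (F : List (PlanarTree X)) : TensorAlgebra k (BR k X) := word k (F.map (tree k))

variable (X)

/-- The basis of `T(BR(X))` given by the planar forests; see `forestBasis_apply`. -/
def forestBasis : Module.Basis (FreeMonoid (PlanarTree X)) k (TensorAlgebra k (BR k X)) :=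
  (Finsupp.basisSingleOne (R := k) (ι := PlanarTree X)).tensorAlgebra

variable {X}

theorem forestBasis_apply (F : FreeMonoid (PlanarTree X)) :
    forestBasis k X F = forest k F.toList := by
  have h : forestBasis k X F = (TensorAlgebra.equivFreeAlgebra
      (Finsupp.basisSingleOne (R := k) (ι := PlanarTree X))).symm
        (FreeAlgebra.equivMonoidAlgebraFreeMonoid.symm (MonoidAlgebra.of k _ F)) := by
    rfl
  rw [h]
  clear h
  induction F using FreeMonoid.recOn with
  | one => rw [map_one, map_one, map_one]; simp [forest, word]
  | of_mul t F ih =>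
    have h : FreeAlgebra.equivMonoidAlgebraFreeMonoid.symm
        (MonoidAlgebra.of k _ (FreeMonoid.of t)) = FreeAlgebra.ι k t := by
      rw [AlgEquiv.symm_apply_eq]
      simp [FreeAlgebra.equivMonoidAlgebraFreeMonoid]
    rw [map_mul, map_mul, map_mul, ih, h]
    simp [forest, word, tree]

theorem forest_nil : forest k ([] : List (PlanarTree X)) = 1 := by simp [forest, word]

theorem forest_cons (t : PlanarTree X) (F : List (PlanarTree X)) :
    forest k (t :: F) = TensorAlgebra.ι k (tree k t) * forest k F := by simp [forest, word]

theorem forest_append (F G : List (PlanarTree X)) :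
    forest k (F ++ G) = forest k F * forest k G := by simp [forest, word]

theorem forest_induction {P : TensorAlgebra k (BR k X) → Prop} (zero : P 0)
    (add : ∀ A B, P A → P B → P (A + B)) (smul : ∀ (c : k) A, P A → P (c • A))
    (forest : ∀ F, P (forest k F)) (A : TensorAlgebra k (BR k X)) : P A := by
  rw [← (forestBasis k X).linearCombination_repr A]
  induction (forestBasis k X).repr A using Finsupp.induction_linear with
  | zero => simpa using zero
  | add f g hf hg => rw [map_add]; exact add _ _ hf hg
  | single F c =>
    rw [Finsupp.linearCombination_single, forestBasis_apply]
    exact smul _ _ (forest _)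

theorem tree_induction {P : BR k X → Prop} (zero : P 0)
    (add : ∀ x y, P x → P y → P (x + y)) (smul : ∀ (c : k) x, P x → P (c • x))
    (tree : ∀ t, P (tree k t)) (x : BR k X) : P x := by
  induction x using Finsupp.induction_linear with
  | zero => exact zero
  | add f g hf hg => exact add _ _ hf hg
  | single t c => simpa [PlanarTree.tree] using smul c _ (tree t)

theorem deconcat_forest (A : List (PlanarTree X)) :
    deconcat k (forest k A) =
      ((splits A).map fun p => forest k p.1 ⊗ₜ[k] forest k p.2).sum := by
  induction A with
  | nil => simp [splits, forest_nil, deconcat_one]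
  | cons t A ih =>
    rw [forest_cons, deconcat_ι_mul, ih, ← Multiset.sum_map_mul_left]
    simp [splits, forest_nil, forest_cons]

variable (X)

/-- The braces of `BR(X)`: `T{T₁ ⋯ Tₙ}` is the sum of all the graftings of `T₁ ⋯ Tₙ` on `T`. -/
def treeBrace : BR k X →ₗ[k] TensorAlgebra k (BR k X) →ₗ[k] BR k X :=
  (Finsupp.basisSingleOne (R := k) (ι := PlanarTree X)).constr k fun t =>
    (forestBasis k X).constr k fun A => ((graft t A.toList).map (tree k)).sum

variable {X}

theorem treeBrace_apply (t : PlanarTree X) (A : List (PlanarTree X)) :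
    treeBrace k X (tree k t) (forest k A) = ((graft t A).map (tree k)).sum := by
  have h1 : treeBrace k X (tree k t) =
      (forestBasis k X).constr k fun A => ((graft t A.toList).map (tree k)).sum := by
    have := (Finsupp.basisSingleOne (R := k) (ι := PlanarTree X)).constr_basis k
      (fun t => (forestBasis k X).constr k fun A => ((graft t A.toList).map (tree k)).sum) t
    simpa [treeBrace, tree] using this
  have h2 := (forestBasis k X).constr_basis k
    (fun A => ((graft t A.toList).map (tree k)).sum) (FreeMonoid.ofList A)
  rw [forestBasis_apply] at h2
  rw [h1]
  simpa using h2

theorem sum_map_bind {α β M : Type*} [AddCommMonoid M] (s : Multiset α) (f : α → Multiset β)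
    (g : β → M) : ((s.bind f).map g).sum = (s.map fun a => ((f a).map g).sum).sum := by
  rw [Multiset.map_bind, Multiset.sum_bind]

theorem insertOne_forest (t : PlanarTree X) (A : List (PlanarTree X)) :
    insertOne (treeBrace k X) (tree k t) (forest k A) =
      ((splits A).map fun p =>
        ((graft t p.2).map fun t' => forest k (p.1 ++ [t'])).sum).sum := by
  simp only [insertOne, LinearMap.mk₂_apply, deconcat_forest, map_multiset_sum, Multiset.map_map,
    Function.comp_def, LinearMap.lTensor_tmul, LinearMap.mul'_apply, LinearMap.comp_apply,
    treeBrace_apply, ← Multiset.sum_map_mul_left]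
  simp [forest_append, forest_cons, forest_nil]

theorem starOf_forest (F A : List (PlanarTree X)) :
    starOf (treeBrace k X) (forest k F) (forest k A) =
      ((graftForest F A).map (forest k)).sum := by
  induction F generalizing A with
  | nil => simp [graftForest, forest_nil, starOf_one]
  | cons t F ih =>
    rw [forest_cons, starOf_ι_mul, deconcat_forest, graftForest]
    simp only [map_multiset_sum, Multiset.map_map, Function.comp_def, TensorProduct.map_tmul,
      LinearMap.mul'_apply, insertOne_forest, ih]
    have key := splits_coassoc A (fun u v w => ((graft t v).bind fun t' =>
        (graftForest F w).map fun F' => u ++ t' :: F'))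
    rw [← key]
    simp only [sum_map_bind, ← Multiset.sum_map_mul_right, ← Multiset.sum_map_mul_left,
      Multiset.map_map, Function.comp_def]
    simp only [forest_append, forest_cons, forest_nil, mul_assoc, mul_one]
    refine congrArg Multiset.sum (Multiset.map_congr rfl fun p _ => ?_)
    rw [Multiset.sum_map_sum_map]
    refine congrArg Multiset.sum (Multiset.map_congr rfl fun q _ => ?_)
    rw [Multiset.sum_map_sum_map]

theorem treeBrace_starOf (x : BR k X) (B C : TensorAlgebra k (BR k X)) :
    treeBrace k X (treeBrace k X x B) C = treeBrace k X x (starOf (treeBrace k X) B C) := by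
  induction x using tree_induction with
  | zero => simp
  | add x y hx hy => simp [hx, hy]
  | smul c x hx => simp [hx]
  | tree t =>
    induction B using forest_induction with
    | zero => simp
    | add x y hx hy => simp [hx, hy]
    | smul c x hx => simp [hx]
    | forest B =>
      induction C using forest_induction with
      | zero => simp
      | add x y hx hy => simp [hx, hy]
      | smul c x hx => simp [hx]
      | forest C =>
        have h := congrArg (fun m => (m.map (tree k)).sum) (graft_graft t B C)
        simp only [sum_map_bind] at h
        have h2 : ∀ m : Multiset (BR k X), treeBrace k X m.sum (forest k C) =
            (m.map fun y => treeBrace k X y (forest k C)).sum := fun m =>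
          map_multiset_sum ((treeBrace k X).flip (forest k C)) m
        rw [starOf_forest, treeBrace_apply, h2]
        simp only [map_multiset_sum, Multiset.map_map, Function.comp_def, treeBrace_apply]
        exact h

mutual
theorem graft_nil : ∀ t : PlanarTree X, graft t [] = {t}
  | node x F => by simp [graft, graftForest_nil F]
theorem graftForest_nil : ∀ F : List (PlanarTree X), graftForest F [] = {F}
  | [] => by simp [graftForest]
  | t :: F => by simp [graftForest, splits, graft_nil t, graftForest_nil F]
end

/-- The brace algebra `BR(X)` of `X`-coloured planar rooted trees. -/
instance braceAlgebra : BraceAlgebra k (BR k X) where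
  brace := treeBrace k X
  brace_one x := by
    induction x using tree_induction with
    | zero => simp
    | add x y hx hy => simp [hx, hy]
    | smul c x hx => simp [hx]
    | tree t => rw [← forest_nil, treeBrace_apply, graft_nil]; simp
  brace_brace x Ys A := by rw [treeBrace_starOf, starOf_word]

/-- `x{T₁ ⋯ Tₙ}` is the tree with root coloured by `x` and branches `T₁, …, Tₙ`. -/
theorem brace_corolla (x : X) (F : List (PlanarTree X)) :
    brace (tree k (node x [])) (forest k F) = tree k (node x F) := by
  simp [brace, treeBrace_apply, graft, graftForest]

mutual
theorem brace_unique_tree (b : BraceAlgebra k (BR k X))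
    (hb : ∀ (x : X) (F : List (PlanarTree X)),
      b.brace (tree k (node x [])) (forest k F) = tree k (node x F)) :
    ∀ (t : PlanarTree X), b.brace (tree k t) = treeBrace k X (tree k t)
  | node x F => by
    have h0 : ∀ A, b.brace (tree k (node x [])) A = treeBrace k X (tree k (node x [])) A := by
      intro A
      induction A using forest_induction with
      | zero => simp
      | add A B hA hB => rw [map_add, map_add, hA, hB]
      | smul c A hA => rw [map_smul, map_smul, hA]
      | forest F =>
        rw [hb, treeBrace_apply]
        simp [graft, graftForest]
    have h1 : ∀ A, treeBrace k X (tree k (node x F)) A =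
        treeBrace k X (tree k (node x [])) (insertBraces (treeBrace k X) (F.map (tree k)) A) := by
      intro A
      rw [← starOf_word, ← treeBrace_starOf, ← h0, ← forest, hb]
    refine LinearMap.ext fun A => ?_
    rw [h1, ← h0, ← brace_unique_forest b hb F, ← b.brace_brace, ← forest, hb]
theorem brace_unique_forest (b : BraceAlgebra k (BR k X))
    (hb : ∀ (x : X) (F : List (PlanarTree X)),
      b.brace (tree k (node x [])) (forest k F) = tree k (node x F)) :
    ∀ (F : List (PlanarTree X)), insertBraces b.brace (F.map (tree k)) =
      insertBraces (treeBrace k X) (F.map (tree k))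
  | [] => by simp [insertBraces]
  | t :: F => by
    have h1 : insertOne b.brace (tree k t) = insertOne (treeBrace k X) (tree k t) := by
      ext1 A
      simp [insertOne, brace_unique_tree b hb t]
    simp [insertBraces, brace_unique_forest b hb F, h1]
end

/-- `BR(X)` carries only one brace algebra structure with the property of `brace_corolla`. -/
theorem brace_unique (b : BraceAlgebra k (BR k X))
    (hb : ∀ (x : X) (F : List (PlanarTree X)),
      b.brace (tree k (node x [])) (forest k F) = tree k (node x F)) :
    b.brace = treeBrace k X := by
  refine LinearMap.ext fun x => ?_
  induction x using tree_induction with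
  | zero => simp
  | add x y hx hy => simp [hx, hy]
  | smul c x hx => simp [hx]
  | tree t => exact brace_unique_tree k b hb t

end Module

/-! Foissy's coproduct.

A cut of `T` is a set of vertices, encoded as a `Bool` on each vertex: `true` on a vertex `v`
means that the edge which goes down from `v` is cut (for the root, think of an edge below it:
cutting there is the total cut). -/

section Cuts

mutual
/-- All the cuts of a tree, admissible or not. -/
def cuts : PlanarTree X → Multiset (PlanarTree (X × Bool))
  | node x F => (cutsForest F).bind fun F' => {node (x, false) F', node (x, true) F'}
/-- All the cuts of a forest, admissible or not. -/
def cutsForest : List (PlanarTree X) → Multiset (List (PlanarTree (X × Bool)))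
  | [] => {[]}
  | t :: F => (cuts t).bind fun t' => (cutsForest F).map fun F' => t' :: F'
end

mutual
/-- The maximal number of cut edges on a path going up from the root. -/
def cutHeight : PlanarTree (X × Bool) → ℕ
  | node x F => (if x.2 then 1 else 0) + cutHeightForest F
/-- The maximal number of cut edges on a path going up from one of the roots. -/
def cutHeightForest : List (PlanarTree (X × Bool)) → ℕ
  | [] => 0
  | t :: F => max (cutHeight t) (cutHeightForest F)
end

/-- A cut is admissible if each path going up from the root meets it at most once. The empty cut
and the total cut are admissible. -/
def IsAdmissible (c : PlanarTree (X × Bool)) : Prop := cutHeight c ≤ 1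

instance (c : PlanarTree (X × Bool)) : Decidable (IsAdmissible c) :=
  inferInstanceAs (Decidable (cutHeight c ≤ 1))

mutual
/-- The tree under a cut. -/
def underlying : PlanarTree (X × Bool) → PlanarTree X
  | node x F => node x.1 (underlyingForest F)
/-- The forest under a cut. -/
def underlyingForest : List (PlanarTree (X × Bool)) → List (PlanarTree X)
  | [] => []
  | t :: F => underlying t :: underlyingForest F
end

mutual
/-- The planar forest `Pᶜ(T)` which an admissible cut detaches from `T`, read from left to
right. -/
def pruned : PlanarTree (X × Bool) → List (PlanarTree X)
  | node x F => if x.2 then [node x.1 (underlyingForest F)] else prunedForest F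
/-- The planar forest which an admissible cut detaches from a forest. -/
def prunedForest : List (PlanarTree (X × Bool)) → List (PlanarTree X)
  | [] => []
  | t :: F => pruned t ++ prunedForest F
end

mutual
/-- The part `Rᶜ(T)` of `T` which contains the root after an admissible cut; it is empty for the
total cut and a single tree for all others. -/
def trunk : PlanarTree (X × Bool) → List (PlanarTree X)
  | node x F => if x.2 then [] else [node x.1 (trunkForest F)]
/-- The part of a forest which contains the roots after an admissible cut. -/
def trunkForest : List (PlanarTree (X × Bool)) → List (PlanarTree X)
  | [] => []
  | t :: F => trunk t ++ trunkForest F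
end

end Cuts

section Foissy
variable (k : Type*) [CommRing k] {X : Type*}

/-- Foissy's coproduct of a tree, `Δ(T) = ∑ Pᶜ(T) ⊗ Rᶜ(T)` over the admissible cuts `c` of `T`
(the empty cut gives `1 ⊗ T`, the total cut gives `T ⊗ 1`). -/
def foissyTree (t : PlanarTree X) :
    TensorAlgebra k (BR k X) ⊗[k] TensorAlgebra k (BR k X) :=
  (((cuts t).filter IsAdmissible).map fun c => forest k (pruned c) ⊗ₜ[k] forest k (trunk c)).sum

variable (X)

/-- The coproduct of Foissy's Hopf algebra of `X`-coloured planar rooted trees: the algebra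
morphism `T(BR(X)) → T(BR(X)) ⊗ T(BR(X))`, for the concatenation product, which extends
`foissyTree`. -/
def foissyCoproduct : TensorAlgebra k (BR k X) →ₐ[k]
    TensorAlgebra k (BR k X) ⊗[k] TensorAlgebra k (BR k X) :=
  TensorAlgebra.lift k (Finsupp.linearCombination k (foissyTree k (X := X)))

open Classical in
/-- The pairing of `T(BR(X))` with itself for which the planar forests are orthonormal. -/
def forestPairing : TensorAlgebra k (BR k X) →ₗ[k] TensorAlgebra k (BR k X) →ₗ[k] k :=
  (forestBasis k X).toDual

open Classical in
theorem forestPairing_forest {X : Type*} (F G : List (PlanarTree X)) :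
    forestPairing k X (forest k F) (forest k G) = if F = G then 1 else 0 := by
  have h := (forestBasis k X).toDual_apply (FreeMonoid.ofList F) (FreeMonoid.ofList G)
  rw [forestBasis_apply, forestBasis_apply] at h
  simpa [forestPairing] using h

/-- The induced pairing `⟨A ⊗ B, C ⊗ D⟩ = ⟨A, C⟩ ⟨B, D⟩` on `T(BR(X)) ⊗ T(BR(X))`. -/
def forestPairingTensor : TensorAlgebra k (BR k X) ⊗[k] TensorAlgebra k (BR k X) →ₗ[k]
    TensorAlgebra k (BR k X) ⊗[k] TensorAlgebra k (BR k X) →ₗ[k] k :=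
  LinearMap.BilinForm.tmul (forestPairing k X) (forestPairing k X)

theorem forestPairingTensor_tmul {X : Type*} (A B C D : TensorAlgebra k (BR k X)) :
    forestPairingTensor k X (A ⊗ₜ B) (C ⊗ₜ D) =
      forestPairing k X A C * forestPairing k X B D := by
  simp [forestPairingTensor, mul_comm]

end Foissy

end PlanarTree

end

-- Both sides are linear in each of `A`, `B`, `C`, so planar forests suffice. There the claim
-- equates two multiplicities: the number of ways to obtain `C` by grafting `A` on `B`, and the
-- number of admissible cuts of `C` with pruned forest `A` and trunk `B`. Grafting and cutting undo
-- each other: the cut passes just below the roots of the grafted trees, and a tree of `A` placed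
-- beside the trees of `B` corresponds to a total cut. The opposite product appears because `*` has
-- the base of the grafting on the left, while Foissy's coproduct has the trunk on the right.
--
-- No bijection is constructed; the two multiplicities obey the same recursion on the first tree
-- `node x F` of `C`. Either this tree is the first tree of `A`, and the cut passes below its root,
-- or it arises from the first tree `node x G` of `B` by grafting an initial part of `A` on it. In
-- the second case `F` is a grafting on `G`, and the rest of `C` is a grafting of the rest of `A` on
-- the rest of `B`. The multiset `cutPairs` is this recursion on the side of cuts:
-- `cutsForest_pruned_trunk` ties it to admissible cuts, `foissyCoproduct_forest` to the coproduct,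
-- and `count_graftForest` to graftings. The distribution of `A` over the two parts is a convolution
-- over its splittings, handled by `sum_splits_count_mul`.

namespace PlanarTree

-- Admissible cuts of forests

section Counting
variable {X : Type*}

/-- The pairs `(Pᶜ(F), Rᶜ(F))` for the admissible cuts `c` of a forest `F`, with multiplicity;
see `cutsForest_pruned_trunk`. -/
def cutPairs : List (PlanarTree X) → Multiset (List (PlanarTree X) × List (PlanarTree X))
  | [] => {([], [])}
  | node x F :: C =>
      (cutPairs C).map (fun q => (node x F :: q.1, q.2)) +
        (cutPairs F).bind fun p => (cutPairs C).map fun q => (p.1 ++ q.1, node x p.2 :: q.2)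

/-- The height of a forest is a maximum, so a bound on it is imposed on each tree independently. The
bound `n` is kept general because both `1` (admissible cuts) and `0` (the empty cut) are needed. -/
theorem filter_cutsForest_cons (n : ℕ) (t : PlanarTree X) (F : List (PlanarTree X)) :
    (cutsForest (t :: F)).filter (fun c => cutHeightForest c ≤ n) =
      ((cuts t).filter fun c => cutHeight c ≤ n).bind fun t' =>
        ((cutsForest F).filter fun c => cutHeightForest c ≤ n).map fun F' => t' :: F' := by
  rw [cutsForest]
  induction cuts t using Multiset.induction with
  | empty => simp
  | cons c s ih =>
    rw [Multiset.cons_bind, Multiset.filter_add, ih, Multiset.filter_map]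
    by_cases h : cutHeight c ≤ n
    · simp [Function.comp_def, cutHeightForest, h]
    · simp [Function.comp_def, cutHeightForest, h]

/-- The two summands separate the cuts that spare the edge below the root from those that use it.
The latter spend one unit of the bound; for `n = 0` there are none. -/
theorem filter_cuts_node (n : ℕ) (x : X) (F : List (PlanarTree X)) :
    (cuts (node x F)).filter (fun c => cutHeight c ≤ n) =
      ((cutsForest F).filter fun c => cutHeightForest c ≤ n).map (node (x, false)) +
        ((cutsForest F).filter fun c => 1 + cutHeightForest c ≤ n).map (node (x, true)) := by
  rw [cuts]
  induction cutsForest F using Multiset.induction with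
  | empty => simp
  | cons c s ih =>
    rw [Multiset.cons_bind, Multiset.filter_add, ih, Multiset.insert_eq_cons,
      ← Multiset.singleton_add, Multiset.filter_add, Multiset.filter_singleton,
      Multiset.filter_singleton]
    simp only [cutHeight, Multiset.filter_cons]
    split_ifs <;> simp_all [Multiset.cons_swap]

/-- Height `0` forces every edge to be uncut, so only the empty cut remains. This is what makes the
total cut of a tree occur exactly once. -/
theorem map_underlyingForest_filter_cutsForest : ∀ F : List (PlanarTree X),
    ((cutsForest F).filter fun c => cutHeightForest c ≤ 0).map underlyingForest = {F}
  | [] => by simp [cutsForest, cutHeightForest, underlyingForest, Multiset.filter_singleton]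
  | node x F :: C => by
    have hF := map_underlyingForest_filter_cutsForest F
    have hC := map_underlyingForest_filter_cutsForest C
    rw [filter_cutsForest_cons, filter_cuts_node]
    simp only [Nat.le_zero, Nat.add_eq_zero_iff, one_ne_zero, false_and, Multiset.filter_false,
      Multiset.map_zero, add_zero, Multiset.bind_map, Multiset.map_bind, Multiset.map_map,
      Function.comp_def, underlyingForest, underlying] at hF hC ⊢
    have h1 : ∀ a : PlanarTree X,
        (((cutsForest C).filter fun c => cutHeightForest c = 0).map fun c =>
          a :: underlyingForest c) = {a :: C} := fun a => by
      simpa [Multiset.map_map] using congrArg (Multiset.map fun G => a :: G) hC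
    simp only [h1, Multiset.bind_singleton]
    simpa [Multiset.map_map] using congrArg (Multiset.map fun G => node x G :: C) hF

/-- The forest statement for the branches is taken as a hypothesis, so that the tree step can serve
inside the recursion over forests and again, afterwards, for the coproduct of a single tree. -/
theorem cuts_pruned_trunk (x : X) (F : List (PlanarTree X))
    (hF : ((cutsForest F).filter fun c => cutHeightForest c ≤ 1).map
      (fun c => (prunedForest c, trunkForest c)) = cutPairs F) :
    ((cuts (node x F)).filter fun c => cutHeight c ≤ 1).map (fun c => (pruned c, trunk c)) =
      (cutPairs F).map (fun p => (p.1, [node x p.2])) + {([node x F], [])} := by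
  -- With the edge below the root cut, admissibility reads `1 + cutHeightForest c ≤ 1`: nothing
  -- above may be cut, which leaves only the total cut.
  have h := congrArg (Multiset.map fun G => ([node x G], ([] : List (PlanarTree X))))
    (map_underlyingForest_filter_cutsForest F)
  rw [filter_cuts_node, ← hF]
  simpa [Multiset.map_map, Function.comp_def, pruned, trunk] using h

theorem cutsForest_pruned_trunk : ∀ F : List (PlanarTree X),
    ((cutsForest F).filter fun c => cutHeightForest c ≤ 1).map
      (fun c => (prunedForest c, trunkForest c)) = cutPairs F
  | [] => by
    simp [cutsForest, cutHeightForest, prunedForest, trunkForest, cutPairs,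
      Multiset.filter_singleton]
  | node x F :: C => by
    have hF := cuts_pruned_trunk x F (cutsForest_pruned_trunk F)
    have hC := cutsForest_pruned_trunk C
    rw [filter_cutsForest_cons, cutPairs, ← hC]
    -- The cuts of the first tree are combined with all admissible cuts of the remaining forest.
    have h := congrArg (fun m => m.bind fun p =>
      ((cutsForest C).filter fun c => cutHeightForest c ≤ 1).map fun c =>
        (p.1 ++ prunedForest c, p.2 ++ trunkForest c)) hF
    simp only [Multiset.bind_map, Multiset.map_bind, Multiset.map_map, Multiset.add_bind,
      Multiset.singleton_bind, Function.comp_def, prunedForest, trunkForest] at h ⊢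
    rw [h, add_comm]
    simp

-- Multiplicities in splittings and concatenations

theorem count_splits {α : Type*} [DecidableEq α] (A P Q : List α) :
    (splits A).count (P, Q) = if P ++ Q = A then 1 else 0 := by
  induction A generalizing P with
  | nil => simp [splits, Multiset.count_singleton]
  | cons a A ih =>
    rw [splits, Multiset.count_cons]
    cases P with
    | nil =>
      rw [Multiset.count_eq_zero.2 (by simp)]
      simp
    | cons p P =>
      by_cases h : p = a
      · subst h
        have hinj : Function.Injective fun q : List α × List α => (p :: q.1, q.2) := by
          rintro ⟨_, _⟩ ⟨_, _⟩ h; simpa using h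
        rw [show (p :: P, Q) = (fun q : List α × List α => (p :: q.1, q.2)) (P, Q) from rfl,
          Multiset.count_map_eq_count' _ _ hinj, ih]
        simp
      · rw [Multiset.count_eq_zero.2 (by simp [Ne.symm h])]
        simp [h]

theorem sum_map_ite_eq {R α : Type*} [NonAssocSemiring R] [DecidableEq α] (s : Multiset α)
    (a : α) : (s.map fun b => if a = b then (1 : R) else 0).sum = s.count a := by
  induction s using Multiset.induction with
  | empty => simp
  | cons b s ih => simp [ih, Multiset.count_cons, add_comm]

/-- Both sides count the pairs from `M` and `N` with labels `G` and `B` whose words concatenate to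
`A`. They are additive in `M` and in `N`, which reduces the claim to one pair `p`, `q`, where the
only splitting that can contribute is `(p.1, q.1)`. -/
theorem sum_splits_count_mul {α ι κ : Type*} [DecidableEq α] [DecidableEq ι] [DecidableEq κ]
    (A : List α) (M : Multiset (List α × ι))
    (N : Multiset (List α × κ)) (G : ι) (B : κ) :
    ((splits A).map fun q => M.count (q.1, G) * N.count (q.2, B)).sum =
      (M.bind fun p => N.map fun q => (p.1 ++ q.1, p.2, q.2)).count (A, G, B) := by
  induction M using Multiset.induction with
  | empty => simp
  | cons p M ih =>
    simp only [Multiset.count_cons, add_mul, Multiset.sum_map_add, ih, Multiset.cons_bind,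
      Multiset.count_add]
    rw [add_comm]
    congr 1
    clear ih
    induction N using Multiset.induction with
    | empty => simp
    | cons q N ih =>
      simp only [Multiset.count_cons, mul_add, Multiset.sum_map_add, ih, Multiset.map_cons]
      congr 1
      -- The label conditions do not depend on the splitting `r`; pulling them out leaves a single
      -- indicator, to be summed by `count_splits`.
      have h : ∀ r : List α × List α, ((if (r.1, G) = p then 1 else 0) *
          if (r.2, B) = q then 1 else 0 : ℕ) =
          if G = p.2 ∧ B = q.2 then (if (p.1, q.1) = r then 1 else 0) else 0 := by
        rintro ⟨_, _⟩
        obtain ⟨_, _⟩ := p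
        obtain ⟨_, _⟩ := q
        simp only [Prod.mk.injEq]
        split_ifs <;> grind
      simp only [h]
      by_cases hG : G = p.2 ∧ B = q.2
      · obtain ⟨rfl, rfl⟩ := hG
        simp only [and_self, if_true]
        rw [sum_map_ite_eq, count_splits, Nat.cast_id]
        exact if_congr (by rw [Prod.mk.injEq, eq_comm]; simp) rfl rfl
      · rw [if_neg (by simpa [Prod.ext_iff] using fun _ h h' => hG ⟨h, h'⟩)]
        simp only [hG, if_false, Multiset.sum_map_zero]

-- Graftings against cuts

/-- Case distinction on the sector to the left of `t`: it is either empty, or receives `a` as the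
first tree of the result. The two cases match, in reverse order, the two summands of `cutPairs`. -/
theorem graftForest_cons_cons (t : PlanarTree X) (B : List (PlanarTree X)) (a : PlanarTree X)
    (A : List (PlanarTree X)) :
    graftForest (t :: B) (a :: A) =
      ((splits (a :: A)).bind fun q => (graft t q.1).bind fun t' =>
        (graftForest B q.2).map fun F' => t' :: F') +
      (graftForest (t :: B) A).map fun R => a :: R := by
  simp [graftForest, splits, Multiset.map_bind, Multiset.bind_map]

theorem count_bind_map_cons {α : Type*} [DecidableEq α] (M : Multiset α) (N : Multiset (List α))
    (s : α)
    (C : List α) :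
    (M.bind fun t => N.map fun F => t :: F).count (s :: C) = M.count s * N.count C := by
  induction M using Multiset.induction with
  | empty => simp
  | cons t M ih =>
    rw [Multiset.cons_bind, Multiset.count_add, ih, Multiset.count_cons, add_mul, add_comm]
    congr 1
    by_cases h : s = t
    · subst h
      simp [Multiset.count_map_eq_count' _ _ (List.cons_injective)]
    · rw [Multiset.count_eq_zero.2 (by simp [Ne.symm h])]
      simp [h]

theorem count_map_cons {α : Type*} [DecidableEq α] (N : Multiset (List α)) (a s : α)
    (C : List α) :
    (N.map fun F => a :: F).count (s :: C) = if a = s then N.count C else 0 := by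
  simpa [Multiset.count_singleton, eq_comm] using count_bind_map_cons {a} N s C

open Classical in
theorem count_map_append_cons (M N : Multiset (List (PlanarTree X) × List (PlanarTree X)))
    (x y : X) (A G B : List (PlanarTree X)) :
    (M.bind fun p => N.map fun q => (p.1 ++ q.1, node x p.2 :: q.2)).count (A, node y G :: B) =
      if x = y then
        (M.bind fun p => N.map fun q => (p.1 ++ q.1, p.2, q.2)).count (A, G, B) else 0 := by
  have hinj : Function.Injective
      fun r : List (PlanarTree X) × List (PlanarTree X) × List (PlanarTree X) =>
        (r.1, node x r.2.1 :: r.2.2) := by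
    rintro ⟨_, _, _⟩ ⟨_, _, _⟩ h
    simpa [and_assoc] using h
  split_ifs with h
  · subst h
    rw [← Multiset.count_map_eq_count' _ _ hinj, Multiset.map_bind]
    simp only [Multiset.map_map, Function.comp_def]
  · rw [Multiset.count_eq_zero]
    simp [h]

open Classical in
theorem count_map_cons_fst (N : Multiset (List (PlanarTree X) × List (PlanarTree X)))
    (s a : PlanarTree X) (A B : List (PlanarTree X)) :
    (N.map fun q => (s :: q.1, q.2)).count (a :: A, B) = if a = s then N.count (A, B) else 0 := by
  have hinj : Function.Injective
      fun q : List (PlanarTree X) × List (PlanarTree X) => (s :: q.1, q.2) := by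
    rintro ⟨_, _⟩ ⟨_, _⟩ h; simpa using h
  split_ifs with h
  · subst h
    exact Multiset.count_map_eq_count' _ _ hinj (A, B)
  · rw [Multiset.count_eq_zero]
    simp [Ne.symm h]

open Classical in
/-- The graftings of `A` on `B` with result `C` correspond to the admissible cuts of `C` with
pruned part `A` and trunk `B`. -/
theorem count_graftForest : ∀ C A B : List (PlanarTree X),
    (graftForest B A).count C = (cutPairs C).count (A, B)
  | [], A, B => by
    cases B with
    | nil => simp [graftForest, cutPairs, Multiset.count_singleton, eq_comm]
    | cons t B =>
      rw [Multiset.count_eq_zero.2 (by simp [graftForest]),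
        Multiset.count_eq_zero.2 (by simp [cutPairs])]
  | node x F :: C, A, B => by
    have hF := count_graftForest F
    have hC := count_graftForest C
    -- The case in which the first tree of `C` comes from the first tree `t` of `B`. On the grafting
    -- side `A` is split between `t` and what lies to its right; on the cut side the pruned parts of
    -- `F` and of `C` are concatenated.
    have key : ∀ (t : PlanarTree X) (B : List (PlanarTree X)),
        ((splits A).bind fun q => (graft t q.1).bind fun t' =>
          (graftForest B q.2).map fun F' => t' :: F').count (node x F :: C) =
        ((cutPairs F).bind fun p => (cutPairs C).map fun q =>
          (p.1 ++ q.1, node x p.2 :: q.2)).count (A, t :: B) := by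
      rintro ⟨y, G⟩ B
      -- Grafting on a tree keeps the colour of its root, and reduces to grafting on its forest of
      -- branches, outer sectors included.
      have hg : ∀ P : List (PlanarTree X), (graft (node y G) P).count (node x F) =
          if x = y then (cutPairs F).count (P, G) else 0 := by
        intro P
        rw [graft]
        split_ifs with h
        · subst h
          rw [Multiset.count_map_eq_count' _ _ (by intro a b h; simpa using h), hF]
        · rw [Multiset.count_eq_zero]
          simp [Ne.symm h]
      rw [count_map_append_cons, ← sum_splits_count_mul, Multiset.count_bind]
      simp only [count_bind_map_cons, hg, hC]
      split_ifs <;> simp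
    rw [cutPairs, Multiset.count_add]
    cases B with
    | nil =>
      -- With an empty trunk every tree must be cut below its root, so only the first summand of
      -- `cutPairs` survives.
      rw [Multiset.count_eq_zero (s := (cutPairs F).bind _) |>.2 (by simp), graftForest, add_zero]
      cases A with
      | nil => rw [Multiset.count_eq_zero.2 (by simp), Multiset.count_eq_zero.2 (by simp)]
      | cons a A =>
        rw [count_map_cons_fst, ← hC, graftForest]
        simp only [Multiset.count_singleton, List.cons.injEq]
        grind
    | cons t B =>
      cases A with
      | nil =>
        -- With nothing pruned, no cut may pass below the root of the first tree, so only the second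
        -- summand survives.
        rw [← key, Multiset.count_eq_zero (s := Multiset.map _ _) |>.2 (by simp), zero_add]
        simp [graftForest, splits]
      | cons a A =>
        rw [graftForest_cons_cons, Multiset.count_add, key, count_map_cons, count_map_cons_fst, hC,
          add_comm]

end Counting

-- The coproduct on forests and the duality

section Duality
variable (k : Type*) [CommRing k] {X : Type*}

/-- The total cut is set apart, since it is the only one whose trunk is not a tree; the empty cut
stays in the sum over `cutPairs F`. -/
theorem foissyTree_node (x : X) (F : List (PlanarTree X)) :
    foissyTree k (node x F) =
      ((cutPairs F).map fun p => forest k p.1 ⊗ₜ[k] forest k [node x p.2]).sum +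
        forest k [node x F] ⊗ₜ[k] 1 := by
  have h := congrArg (fun m => (m.map fun p => forest k p.1 ⊗ₜ[k] forest k p.2).sum)
    (cuts_pruned_trunk x F (cutsForest_pruned_trunk F))
  simp only [Multiset.map_map, Function.comp_def, Multiset.map_add, Multiset.sum_add,
    Multiset.map_singleton, Multiset.sum_singleton, forest_nil] at h
  exact h

theorem foissyCoproduct_ι_tree (t : PlanarTree X) :
    foissyCoproduct k X (TensorAlgebra.ι k (tree k t)) = foissyTree k t := by
  simp [foissyCoproduct, tree]

/-- A cut of a forest is an independent choice of a cut of each tree, with pruned parts and trunks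
concatenated in order. This is the multiplicativity of the coproduct. -/
theorem foissyCoproduct_forest (C : List (PlanarTree X)) :
    foissyCoproduct k X (forest k C) =
      ((cutPairs C).map fun p => forest k p.1 ⊗ₜ[k] forest k p.2).sum := by
  induction C with
  | nil => simp [forest_nil, cutPairs, Algebra.TensorProduct.one_def]
  | cons t C ih =>
    obtain ⟨x, F⟩ := t
    rw [forest_cons, map_mul, ih, foissyCoproduct_ι_tree, foissyTree_node, add_mul, add_comm,
      cutPairs, Multiset.map_add, Multiset.sum_add, sum_map_bind, ← Multiset.sum_map_mul_right,
      ← Multiset.sum_map_mul_left]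
    simp only [← Multiset.sum_map_mul_left, Multiset.map_map,
      Function.comp_def, Algebra.TensorProduct.tmul_mul_tmul, one_mul, ← forest_append,
      List.singleton_append]

theorem starMul_forest (B A : List (PlanarTree X)) :
    BraceAlgebra.starMul k (BR k X) (forest k B) (forest k A) =
      ((graftForest B A).map (forest k)).sum :=
  starOf_forest k B A

theorem forestPairingTensor_foissyCoproduct_forest (A B C : List (PlanarTree X)) :
    forestPairingTensor k X (foissyCoproduct k X (forest k C)) (forest k A ⊗ₜ forest k B) =
      forestPairing k X (forest k C)
        (BraceAlgebra.starMul k (BR k X) (forest k B) (forest k A)) := by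
  classical
  have hL := map_multiset_sum ((forestPairingTensor k X).flip (forest k A ⊗ₜ[k] forest k B))
    ((cutPairs C).map fun p => forest k p.1 ⊗ₜ[k] forest k p.2)
  simp only [Multiset.map_map, Function.comp_def, LinearMap.flip_apply, forestPairingTensor_tmul,
    forestPairing_forest] at hL
  rw [foissyCoproduct_forest, hL, starMul_forest, map_multiset_sum]
  simp only [Multiset.map_map, Function.comp_def, forestPairing_forest]
  -- Sums of Kronecker deltas are multiplicities cast into `k`. The equality is between natural
  -- numbers, so it holds over every `k`.
  rw [sum_map_ite_eq, count_graftForest, ← sum_map_ite_eq]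
  refine congrArg Multiset.sum (Multiset.map_congr rfl fun p _ => ?_)
  obtain ⟨P, R⟩ := p
  simp only [Prod.mk.injEq, ite_zero_mul_ite_zero, one_mul, eq_comm]

end Duality

end PlanarTree

theorem theorem5p1p3 {k : Type*} [CommRing k] {X : Type*}
    (A B C : TensorAlgebra k (PlanarTree.BR k X)) :
    PlanarTree.forestPairingTensor k X (PlanarTree.foissyCoproduct k X C) (A ⊗ₜ[k] B) =
      PlanarTree.forestPairing k X C
        ((BraceAlgebra.starMul k (PlanarTree.BR k X)).flip A B) := by
  induction C using PlanarTree.forest_induction with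
  | zero => simp
  | add x y hx hy => simp [hx, hy]
  | smul c x hx => simp [hx]
  | forest C =>
    induction A using PlanarTree.forest_induction with
    | zero => simp
    | add x y hx hy => simp [TensorProduct.add_tmul, hx, hy]
    | smul c x hx => simp [← TensorProduct.smul_tmul', hx]
    | forest A =>
      induction B using PlanarTree.forest_induction with
      | zero => simp
      | add x y hx hy => simp [TensorProduct.tmul_add, hx, hy]
      | smul c x hx => simp [hx]
      | forest B =>
        exact PlanarTree.forestPairingTensor_foissyCoproduct_forest k A B C
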